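/- An interval parity game over $M$ real-extended variables consists of a set $V$ of positions, partitioned into positions $V_0,V_1$ of players $0$ and $1$; transitions $E\subseteq V\times V$, each carrying a finite set of labels $(I,(C_i)_{i\le M},R)$, where $I\subseteq[0,\infty]$ is an interval of possible elapsed times, the intervals $C_i\subseteq[-\infty,\infty]$ are constraints and $R\subseteq\{1,\dots,M\}$ is a reset set; rates $a_i(v)\in\mathbb R$; a payoff function $\iota(v)=a\cdot y_i+b$ (with $i,a,b$ depending on $v$, $a,b\in\mathbb R\cup\{\pm\infty\}$); and a bounded priority function on $V$ with values in $\mathbb N$. A state is $s=(v,y_1,\dots,y_M)$ with $y_i\in\mathbb R\cup\{\pm\infty\}$. A state $s'=(v',y')$ is a successor of $s$ if $(v,v')\in E$ has a label $(I,C,R)$ with $y_i\in C_i$ for all $i$, $y'_i=0$ for $i\in R$, and for some $t\in I$, $y'_i=y_i+a_i(v)t$ for all $i\notin R$. The owner of the current position chooses a successor. A play that reaches a state without successors ends there with payoff $a\cdot y_i+b$ given by $\iota$; an infinite play has payoff $\infty$ if the lowest priority seen infinitely often is even, and $-\infty$ otherwise. Player $0$ maximises and player $1$ minimises. A strategy of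 player $i$ assigns to every finite sequence of states ending in a state of player $i$ that has a successor such a successor; $\pi(\sigma,\rho,s)$ is the play from $s$ consistent with $\sigma$ and $\rho$. The game is flat if all rates are $1$. It is over $\mathbb Z_\infty=\mathbb Z\cup\{\pm\infty\}$ if all interval endpoints and all constants $a,b$ in $\iota$ lie in $\mathbb Z_\infty$. Two states $s,t$ are equivalent, $s\sim t$, if they have the same position, $\lfloor y_i(s)\rfloor=\lfloor y_i(t)\rfloor$ and $\lceil y_i(s)\rceil=\lceil y_i(t)\rceil$ for all $i$, and for all $i,j$ the fractional parts satisfy $\{y_i(s)\}\le\{y_j(s)\}$ if and only if $\{y_i(t)\}\le\{y_j(t)\}$ (infinite values are their own floor and ceiling and have fractional part $0$). For real $r$ let $d(r)=r-\lceil r\rceil$ if $|r-\lceil r\rceil|\le|r-\lfloor r\rfloor|$ and $d(r)=r-\lfloor r\rfloor$ otherwise, and $d(\pm\infty)=0$; put $d_l(s)=\min_i d(y_i(s))$, $d_r(s)=\max_i d(y_i(s))$, and let $d^*(s)$ be $|d_l(s)|$ if all $d(y_i(s))\le0$, $d_r(s)$ if all $d(y_i(s))\ge0$, and $|d_l(s)|+d_r(s)$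 otherwise. A strategy $\sigma$ is $\varepsilon$-discrete if for every $s_{n+1}=\sigma(s_0\dots s_n)$, $d^*(s_n)\le\varepsilon$ implies $d^*(s_{n+1})\le d^*(s_n)+\varepsilon/2^{n+1}$, and if $\sigma(s_0\dots s_n)\sim\sigma(s'_0\dots s'_n)$ whenever $s_k\sim s'_k$ for all $k\le n$. Proposition. Let $\mathcal G$ be a flat interval parity game over $\mathbb Z_\infty$ and let $0<\varepsilon<\frac14$. Let $\Gamma_i$ be the set of all strategies of player $i$ and $\Delta_i$ the set of all $\varepsilon$-discrete strategies of player $i$, and let $m\in[0,\infty]$ be the supremum (for finite $V$, the maximum) over all positions of the absolute value $|a|$ of the multiplicative factor $a$ in $\iota$. Then for every state $s$ (in particular for every starting state, where all variables are $0$) \[\Bigl|\sup_{\sigma\in\Gamma_0}\inf_{\rho\in\Gamma_1}\mathrm{p}(\pi(\sigma,\rho,s))-\sup_{\sigma\in\Delta_0}\inf_{\rho\in\Delta_1}\mathrm{p}(\pi(\sigma,\rho,s))\Bigr|\le m,\] where $\mathrm p$ is the payoff and $|x-y|$ is read as $0$ when $x=y=\infty$ or $x=y=-\infty$. The arithmetic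 of $[-\infty,\infty]$ uses $0\cdot(\pm\infty)=0$ and $\infty+(-\infty)=-\infty$. -/

import Mathlib

open Filter
open scoped ENNReal

noncomputable section

namespace IntervalGame

/-! ### Linear hybrid systems -/

/-- An open, closed or half-open interval of extended reals, given by its endpoints. -/
structure Interval where
  lo : EReal
  hi : EReal
  loClosed : Prop
  hiClosed : Prop

/-- The points of an interval. -/
def Interval.points (I : Interval) : Set EReal :=
  {x | (I.lo < x ∨ (I.loClosed ∧ I.lo = x)) ∧ (x < I.hi ∨ (I.hiClosed ∧ x = I.hi))}

/-- The extended integers, as a set of extended reals. -/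
def extInt : Set EReal := {x | x = ⊥ ∨ x = ⊤ ∨ ∃ n : ℤ, x = ((n : ℝ) : EReal)}

/-- An interval with endpoints in the extended integers. -/
def Interval.OverInt (I : Interval) : Prop := I.lo ∈ extInt ∧ I.hi ∈ extInt

/-- A transition label: the interval of possible elapsed times (an interval of nonnegative extended
reals), the constraint interval of each variable, and the set of variables that are reset. -/
structure Label (M : ℕ) where
  time : Interval
  time_nonneg : 0 ≤ time.lo
  constraint : Fin M → Interval
  reset : Set (Fin M)

/-- A linear hybrid system over `M` variables (without predicates), with set of locations `V`:
the transitions, the finite set of labels of each transition, and the rate at which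
each variable evolves in each location. -/
structure LinearHybridSystem (V : Type*) (M : ℕ) where
  E : Set (V × V)
  label : E → Finset (Label M)
  coeff : V → Fin M → ℝ

/-- A state: a location together with a valuation of the variables. -/
structure State (V : Type*) (M : ℕ) where
  loc : V
  var : Fin M → EReal

variable {V : Type*} {M : ℕ}

/-- The move from `s` to `s'` is allowed by the label `l` (for the rates `coeff`): the values in `s`
satisfy the constraints, and after some time `t` in the time interval of the label
the reset variables are zero and the others have evolved at their rates. -/
def LinearHybridSystem.AllowedBy (K : LinearHybridSystem V M) (l : Label M)
    (s s' : State V M) : Prop :=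
  (∀ i, s.var i ∈ (l.constraint i).points) ∧
    (∀ i ∈ l.reset, s'.var i = 0) ∧
    ∃ t ∈ l.time.points, ∀ i ∉ l.reset, s'.var i = s.var i + (K.coeff s.loc i : EReal) * t

/-- The successors of a state. -/
def LinearHybridSystem.succ (K : LinearHybridSystem V M) (s : State V M) : Set (State V M) :=
  {s' | ∃ e : K.E, e.1 = (s.loc, s'.loc) ∧ ∃ l ∈ K.label e, K.AllowedBy l s s'}

/-! ### Interval parity games -/

/-- An interval parity game over `M` variables with set of positions `V`. The function `owner` gives
the partition of the positions between players `0` and `1`. The payoff function `ι` is given by its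
three components: `ι(v) = mult v * y_(idx v) + offset v`. -/
structure IPG (V : Type*) (M : ℕ) extends LinearHybridSystem V M where
  owner : V → Fin 2
  idx : V → Fin M
  mult : V → EReal
  offset : V → EReal
  maxPriority : ℕ
  priority : V → Fin (maxPriority + 1)

namespace IPG

/-- A game is flat if all variables evolve at rate one everywhere. -/
def Flat (G : IPG V M) : Prop := ∀ v i, G.coeff v i = 1

/-- A game over the extended integers: all endpoints in labels and all constants in the payoff
function are extended integers. -/
def OverInt (G : IPG V M) : Prop :=
  (∀ e, ∀ l ∈ G.label e, l.time.OverInt ∧ ∀ i, (l.constraint i).OverInt) ∧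
    ∀ v, G.mult v ∈ extInt ∧ G.offset v ∈ extInt

/-- The largest absolute value of a multiplicative factor in the payoff function. -/
def maxMult (G : IPG V M) : ℝ≥0∞ := ⨆ v, (G.mult v).abs

/-- A strategy for player `i`. Here `move h s` is the choice after the finite history `h`
(in chronological order) followed by the current state `s`; its value is irrelevant
if `s` does not belong to player `i` or has no successor. -/
structure Strategy (G : IPG V M) (i : Fin 2) where
  move : List (State V M) → State V M → State V M
  move_mem : ∀ h s, G.owner s.loc = i → (G.succ s).Nonempty → move h s ∈ G.succ s

open Classical in
/-- The history and the current state after `n` rounds of the play from `s` that is consistent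
with both strategies. Once a state without successors is reached, the play has ended, and the
history and current state no longer change. -/
def play (G : IPG V M) (σ : G.Strategy 0) (ρ : G.Strategy 1) (s : State V M) :
    ℕ → List (State V M) × State V M
  | 0 => ([], s)
  | n + 1 =>
    let p := play G σ ρ s n
    if (G.succ p.2).Nonempty then
      (p.1 ++ [p.2], if G.owner p.2.loc = 0 then σ.move p.1 p.2 else ρ.move p.1 p.2)
    else p

/-- The payoff of a finite play ending in `s`. -/
def finalPay (G : IPG V M) (s : State V M) : EReal :=
  G.mult s.loc * s.var (G.idx s.loc) + G.offset s.loc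

/-- The lowest priority seen infinitely often along a sequence of states. -/
def lowestPriority (G : IPG V M) (p : ℕ → State V M) : ℕ :=
  sInf {k : ℕ | ∃ᶠ n in atTop, (G.priority (p n).loc : ℕ) = k}

open Classical in
/-- The payoff of the play from `s` that is consistent with `σ` and `ρ`: if the play reaches a state
without successors, it is given by the payoff function in that state; otherwise it is `∞` or `-∞`
according to whether the lowest priority seen infinitely often is even or odd. -/
def pay (G : IPG V M) (σ : G.Strategy 0) (ρ : G.Strategy 1) (s : State V M) : EReal :=
  if h : ∃ n, G.succ (G.play σ ρ s n).2 = ∅ then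
    G.finalPay (G.play σ ρ s (Nat.find h)).2
  else if Even (G.lowestPriority fun n => (G.play σ ρ s n).2) then ⊤ else ⊥

end IPG

/-! ### Discrete strategies -/

open Classical in
/-- Floor of an extended real (an infinite value is its own floor). -/
def extFloor (x : EReal) : EReal :=
  if x = ⊤ ∨ x = ⊥ then x else ((⌊x.toReal⌋ : ℝ) : EReal)

open Classical in
/-- Ceiling of an extended real (an infinite value is its own ceiling). -/
def extCeil (x : EReal) : EReal :=
  if x = ⊤ ∨ x = ⊥ then x else ((⌈x.toReal⌉ : ℝ) : EReal)

/-- Fractional part of an extended real; it is `0` for `∞` and `-∞`. -/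
def extFract (x : EReal) : ℝ := Int.fract x.toReal

/-- Equivalence of states: same location, same floors and ceilings of the values of the variables,
and same order of the fractional parts. -/
def State.Equivalent (s t : State V M) : Prop :=
  s.loc = t.loc ∧
    (∀ i, extFloor (s.var i) = extFloor (t.var i) ∧ extCeil (s.var i) = extCeil (t.var i)) ∧
    ∀ i j, extFract (s.var i) ≤ extFract (s.var j) ↔ extFract (t.var i) ≤ extFract (t.var j)

/-- Signed distance of a real number to the closest integer, negative if that integer is greater. -/
def intDist (r : ℝ) : ℝ :=
  if |r - ⌈r⌉| ≤ |r - ⌊r⌋| then r - ⌈r⌉ else r - ⌊r⌋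

/-- Signed distance of the `i`-th variable to the closest integer; it is `0` for infinite values. -/
def State.dist (s : State V M) (i : Fin M) : ℝ := intDist (s.var i).toReal

/-- The smallest signed distance of a variable. -/
def State.distL (s : State V M) : ℝ := ⨅ i, s.dist i

/-- The biggest signed distance of a variable. -/
def State.distR (s : State V M) : ℝ := ⨆ i, s.dist i

open Classical in
/-- The total distance of a state. -/
def State.totalDist (s : State V M) : ℝ :=
  if ∀ i, s.dist i ≤ 0 then |s.distL|
  else if ∀ i, 0 ≤ s.dist i then s.distR
  else |s.distL| + s.distR

/-- A strategy of player `i` is `ε`-discrete if each of its moves, made after a history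
`h = s₀ … sₙ₋₁` in a state `s = sₙ` of total distance at most `ε`, increases the total distance by
at most `ε / 2 ^ (n + 1)`, and if it makes equivalent moves after equivalent histories. -/
def IPG.Strategy.IsDiscrete {G : IPG V M} {i : Fin 2} (σ : G.Strategy i) (ε : ℝ) : Prop :=
  (∀ h s, G.owner s.loc = i → (G.succ s).Nonempty → s.totalDist ≤ ε →
      (σ.move h s).totalDist ≤ s.totalDist + ε / 2 ^ (h.length + 1)) ∧
    ∀ h s h' s', G.owner s.loc = i → (G.succ s).Nonempty → (G.succ s').Nonempty →
      List.Forall₂ State.Equivalent h h' → s.Equivalent s' →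
      (σ.move h s).Equivalent (σ.move h' s')

/-! ### Values -/

/-- The sup-inf value of a game at a state, over all strategies. -/
def IPG.supInf (G : IPG V M) (s : State V M) : EReal :=
  ⨆ σ : G.Strategy 0, ⨅ ρ : G.Strategy 1, G.pay σ ρ s

/-- The sup-inf value of a game at a state, over all `ε`-discrete strategies. -/
def IPG.discreteSupInf (G : IPG V M) (ε : ℝ) (s : State V M) : EReal :=
  ⨆ σ : {σ : G.Strategy 0 // σ.IsDiscrete ε}, ⨅ ρ : {ρ : G.Strategy 1 // ρ.IsDiscrete ε},
    G.pay σ.1 ρ.1 s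

open Classical in
/-- The distance `|x - y|` of two extended reals, where `|∞ - ∞| = |-∞ - (-∞)| = 0`. -/
def extDist (x y : EReal) : ℝ≥0∞ := if x = y then 0 else (x - y).abs

end IntervalGame

end

/-! Equivalence of states is the region equivalence of timed automata. In a flat game over the
extended integers it is a bisimulation: the constraints and time intervals see only floors and
ceilings, and a uniform delay carries a variable past the next integer according to how its
fractional part compares with one threshold. From an equivalent state a delay with the matching
threshold reaches an equivalent successor (`SameRegion.exists_shift`). That delay can be taken to
bring some variable, or the constant 0, to an integer or just short of one, so the total distance
hardly grows (`IPG.exists_succ_equivalent`). Hence any rule for choosing regions from the regions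
seen so far is realised by a discrete strategy (`IPG.exists_isDiscrete`).

It remains to compare plays region by region. A discrete strategy of player 0 cannot distinguish a
reply from a discrete reply through the same regions (`IPG.exists_discrete_response`). An arbitrary
strategy of player 0 is copied by a discrete one that reconstructs, from the regions alone, a play
of the original (`IPG.exists_discrete_simulation`). Plays through the same regions end at the same
time or have the same priorities. Their final values are equal and infinite, or differ by less than
1, so the payoffs differ by at most the largest factor (`IPG.pay_le_pay_add`). The two simulations
give the two inequalities; determinacy is not needed. -/

noncomputable section

namespace IntervalGame

/-! ### Regions of real vectors -/

/-- Two families of reals have the same floors and ceilings and the same order of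
fractional parts. -/
def SameRegion {ι : Type*} (x y : ι → ℝ) : Prop :=
  (∀ i, ⌊x i⌋ = ⌊y i⌋ ∧ ⌈x i⌉ = ⌈y i⌉) ∧
    ∀ i j, Int.fract (x i) ≤ Int.fract (x j) ↔ Int.fract (y i) ≤ Int.fract (y j)

lemma fract_eq_zero_iff_floor_eq_ceil (x : ℝ) : Int.fract x = 0 ↔ ⌊x⌋ = ⌈x⌉ := by
  constructor
  · intro h
    have : x = (⌊x⌋ : ℝ) := by
      have := Int.fract_add_floor x
      linarith
    rw [this]
    simp
  · intro h
    have h1 := Int.floor_le x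
    have h2 := Int.le_ceil x
    rw [← h] at h2
    rw [Int.fract]
    linarith

lemma ceil_eq_floor_add_one {x : ℝ} (h : Int.fract x ≠ 0) : ⌈x⌉ = ⌊x⌋ + 1 := by
  have h0 := lt_of_le_of_ne (Int.fract_nonneg x) (Ne.symm h)
  have h1 := Int.fract_add_floor x
  rw [Int.ceil_eq_iff]
  push_cast
  constructor
  · linarith
  · linarith [Int.lt_floor_add_one x]

lemma floor_ceil_eq_of_fract {x y : ℝ} (hfl : ⌊x⌋ = ⌊y⌋)
    (h0 : Int.fract x = 0 ↔ Int.fract y = 0) : ⌊x⌋ = ⌊y⌋ ∧ ⌈x⌉ = ⌈y⌉ := by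
  refine ⟨hfl, ?_⟩
  by_cases h : Int.fract x = 0
  · rw [← (fract_eq_zero_iff_floor_eq_ceil x).1 h,
      ← (fract_eq_zero_iff_floor_eq_ceil y).1 (h0.1 h), hfl]
  · rw [ceil_eq_floor_add_one h, ceil_eq_floor_add_one (mt h0.2 h), hfl]

lemma SameRegion.fract_eq_zero_iff {ι : Type*} {x y : ι → ℝ} (h : SameRegion x y) (i : ι) :
    Int.fract (x i) = 0 ↔ Int.fract (y i) = 0 := by
  rw [fract_eq_zero_iff_floor_eq_ceil, fract_eq_zero_iff_floor_eq_ceil, (h.1 i).1, (h.1 i).2]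

open Classical in
/-- Replacing the coordinates in a given set by zero preserves being in the same region. -/
lemma SameRegion.zero_on {ι : Type*} {x y : ι → ℝ} (h : SameRegion x y) (S : Set ι) :
    SameRegion (fun i => if i ∈ S then 0 else x i) (fun i => if i ∈ S then 0 else y i) := by
  refine ⟨fun i => ?_, fun i j => ?_⟩
  · by_cases hi : i ∈ S <;> simp [hi, h.1 i]
  · by_cases hi : i ∈ S <;> by_cases hj : j ∈ S <;> simp only [hi, hj, if_true, if_false]
    · simp [Int.fract_nonneg]
    · have e := h.fract_eq_zero_iff i
      simp only [Int.fract_zero]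
      rw [(Int.fract_nonneg (x i)).ge_iff_eq', (Int.fract_nonneg (y i)).ge_iff_eq']
      exact e
    · exact h.2 i j

/-- A threshold in `(0, 1]` can be transported along an order isomorphism of finite sets of
fractional parts, and chosen at or shortly after one of these parts. -/
lemma exists_threshold {ι : Type*} [Finite ι] {f g : ι → ℝ} (hg : ∀ i, 0 ≤ g i)
    (hg1 : ∀ i, g i < 1) (hf1 : ∀ i, f i < 1) (h : ∀ i j, f i ≤ f j ↔ g i ≤ g j) (o : ι)
    (hfo : f o = 0) (hgo : g o = 0) {c δ : ℝ} (hc : 0 < c) (hc1 : c ≤ 1) (hδ : 0 < δ) :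
    ∃ c', 0 < c' ∧ c' ≤ 1 ∧ (c = 1 ↔ c' = 1) ∧
      (∀ i, (f i < c ↔ g i < c') ∧ (f i = c ↔ g i = c')) ∧
      (c' = 1 ∨ ∃ j, g j ≤ c' ∧ c' ≤ g j + δ) := by
  have hlt : ∀ i j, f i < f j ↔ g i < g j := fun i j => by
    rw [← not_le, ← not_le, h]
  by_cases h1 : c = 1
  · subst h1
    exact ⟨1, one_pos, le_rfl, by simp, fun i => ⟨by simp [hf1, hg1],
      by simp [(hf1 i).ne, (hg1 i).ne]⟩, Or.inl rfl⟩
  by_cases h2 : ∃ j, f j = c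
  · obtain ⟨j, rfl⟩ := h2
    refine ⟨g j, ?_, (hg1 j).le, ?_, fun i => ⟨hlt i j, ?_⟩, Or.inr ⟨j, le_rfl, by linarith⟩⟩
    · rw [← hgo, ← hlt, hfo]; exact hc
    · simp [(hf1 j).ne, (hg1 j).ne]
    · rw [le_antisymm_iff, le_antisymm_iff, h, h]
  push Not at h2
  have : Nonempty {i // f i < c} := ⟨⟨o, by rw [hfo]; exact hc⟩⟩
  obtain ⟨⟨a, ha⟩, hamax⟩ := Finite.exists_max fun i : {i // f i < c} => g i
  have hb : ∃ b, g a < b ∧ b ≤ 1 ∧ ∀ i, c < f i → b ≤ g i := by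
    by_cases hne : Nonempty {i // c < f i}
    · obtain ⟨⟨b, hb⟩, hbmin⟩ := Finite.exists_min fun i : {i // c < f i} => g i
      exact ⟨g b, (hlt a b).1 (ha.trans hb), (hg1 b).le, fun i hi => hbmin ⟨i, hi⟩⟩
    · exact ⟨1, hg1 a, le_rfl, fun i hi => absurd ⟨⟨i, hi⟩⟩ hne⟩
  obtain ⟨b, hab, hb1, hbmin⟩ := hb
  -- No part equals `c`, so `c'` may lie anywhere in the gap between the neighbouring values of `g`;
  -- it is placed within `δ` of the lower one.
  obtain ⟨c', hc'a, hc'⟩ := exists_between (lt_min hab (by linarith : g a < g a + δ))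
  rw [lt_min_iff] at hc'
  have key : ∀ i, (f i < c ∧ g i < c') ∨ (c < f i ∧ c' < g i) := fun i => by
    rcases lt_or_gt_of_ne (h2 i) with hi | hi
    · exact Or.inl ⟨hi, (hamax ⟨i, hi⟩).trans_lt hc'a⟩
    · exact Or.inr ⟨hi, hc'.1.trans_le (hbmin i hi)⟩
  refine ⟨c', (hg a).trans_lt hc'a, hc'.1.le.trans hb1, ?_, fun i => ?_,
    Or.inr ⟨a, hc'a.le, hc'.2.le⟩⟩
  · simp [h1, (hc'.1.trans_le hb1).ne]
  · rcases key i with ⟨p, q⟩ | ⟨p, q⟩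
    · simp [p, q, p.ne, q.ne]
    · simp [p.not_gt, q.not_gt, p.ne', q.ne']

/-- Every shift is `k + 1 - c` with `k` an integer and `0 < c ≤ 1`. The number `c` is the threshold:
fractional parts below it stay short of the extra integer, those from `c` on reach it. -/
lemma floor_fract_shift_of_lt {x c : ℝ} (k : ℤ) (hc1 : c ≤ 1) (h : Int.fract x < c) :
    ⌊x + (k + 1 - c)⌋ = ⌊x⌋ + k ∧ Int.fract (x + (k + 1 - c)) = Int.fract x + 1 - c := by
  have e := Int.fract_add_floor x
  have h0 := Int.fract_nonneg x
  have : ⌊x + (k + 1 - c)⌋ = ⌊x⌋ + k := by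
    rw [Int.floor_eq_iff]; push_cast; constructor <;> linarith
  refine ⟨this, ?_⟩
  rw [Int.fract, this]; push_cast; linarith

lemma floor_fract_shift_of_le {x c : ℝ} (k : ℤ) (hc : 0 < c) (h : c ≤ Int.fract x) :
    ⌊x + (k + 1 - c)⌋ = ⌊x⌋ + k + 1 ∧ Int.fract (x + (k + 1 - c)) = Int.fract x - c := by
  have e := Int.fract_add_floor x
  have h0 := Int.fract_lt_one x
  have : ⌊x + (k + 1 - c)⌋ = ⌊x⌋ + k + 1 := by
    rw [Int.floor_eq_iff]; push_cast; constructor <;> linarith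
  refine ⟨this, ?_⟩
  rw [Int.fract, this]; push_cast; linarith

/-- A shift of a vector can be simulated from any vector in the same region,
by a shift that brings some coordinate to, or shortly before, an integer. -/
lemma SameRegion.exists_shift {ι : Type*} [Finite ι] {x y : ι → ℝ} (h : SameRegion x y) (o : ι)
    (hxo : x o = 0) (hyo : y o = 0) (τ : ℝ) {δ : ℝ} (hδ : 0 < δ) :
    ∃ τ' : ℝ, SameRegion (fun i => x i + τ) (fun i => y i + τ') ∧
      ∃ (j : ι) (η : ℝ) (k : ℤ), 0 ≤ η ∧ η ≤ δ ∧ τ' = k - y j - η := by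
  have hc : 0 < 1 - Int.fract τ := by linarith [Int.fract_lt_one τ]
  have hc1 : 1 - Int.fract τ ≤ 1 := by linarith [Int.fract_nonneg τ]
  have hτ : τ = ⌊τ⌋ + 1 - (1 - Int.fract τ) := by linarith [Int.fract_add_floor τ]
  obtain ⟨c', hc', hc1', hone, hcmp, hnear⟩ := exists_threshold
    (f := fun i => Int.fract (x i)) (g := fun i => Int.fract (y i)) (fun i => Int.fract_nonneg _)
    (fun i => Int.fract_lt_one _) (fun i => Int.fract_lt_one _) h.2 o (by simp [hxo])
    (by simp [hyo]) hc hc1 hδ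
  generalize 1 - Int.fract τ = c at *
  generalize ⌊τ⌋ = k at *
  subst hτ
  refine ⟨k + 1 - c', ⟨fun i => ?_, fun i j => ?_⟩, ?_⟩
  · have hxi := Int.fract_nonneg (x i)
    have hyi := Int.fract_nonneg (y i)
    have hz := h.fract_eq_zero_iff i
    rcases lt_or_ge (Int.fract (x i)) c with hi | hi
    · obtain ⟨p1, p2⟩ := floor_fract_shift_of_lt k hc1 hi
      obtain ⟨q1, q2⟩ := floor_fract_shift_of_lt k hc1' ((hcmp i).1.1 hi)
      refine floor_ceil_eq_of_fract (by rw [p1, q1, (h.1 i).1]) ?_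
      rw [p2, q2]
      constructor
      -- A sum of the nonnegative terms `Int.fract (x i)` and `1 - c` vanishes only if both do, that
      -- is, for an integer shift of an integer.
      · intro e
        have e1 : c = 1 := by linarith
        have e2 := hone.1 e1
        have e3 := hz.1 (by linarith)
        linarith
      · intro e
        have e1 : c' = 1 := by linarith
        have e2 := hone.2 e1
        have e3 := hz.2 (by linarith)
        linarith
    · obtain ⟨p1, p2⟩ := floor_fract_shift_of_le k hc hi
      obtain ⟨q1, q2⟩ := floor_fract_shift_of_le k hc' (not_lt.1 (mt (hcmp i).1.2 hi.not_gt))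
      refine floor_ceil_eq_of_fract (by rw [p1, q1, (h.1 i).1]) ?_
      rw [p2, q2, sub_eq_zero, sub_eq_zero]
      exact (hcmp i).2
  · have hij := h.2 i j
    have a1 := Int.fract_nonneg (x i)
    have a2 := Int.fract_nonneg (y i)
    have a3 := Int.fract_nonneg (x j)
    have a4 := Int.fract_nonneg (y j)
    have b1 := Int.fract_lt_one (x i)
    have b2 := Int.fract_lt_one (y i)
    have b3 := Int.fract_lt_one (x j)
    have b4 := Int.fract_lt_one (y j)
    rcases lt_or_ge (Int.fract (x i)) c with hi | hi <;>
    rcases lt_or_ge (Int.fract (x j)) c with hj | hj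
    · rw [(floor_fract_shift_of_lt k hc1 hi).2, (floor_fract_shift_of_lt k hc1 hj).2,
        (floor_fract_shift_of_lt k hc1' ((hcmp i).1.1 hi)).2,
        (floor_fract_shift_of_lt k hc1' ((hcmp j).1.1 hj)).2]
      simpa using hij
    · rw [(floor_fract_shift_of_lt k hc1 hi).2, (floor_fract_shift_of_le k hc hj).2,
        (floor_fract_shift_of_lt k hc1' ((hcmp i).1.1 hi)).2,
        (floor_fract_shift_of_le k hc' (not_lt.1 (mt (hcmp j).1.2 hj.not_gt))).2]
      -- Parts below the threshold land in `[1 - c, 1)`, the others in `[0, 1 - c)`. The order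
      -- across the threshold is therefore forced, on both sides alike.
      constructor <;> intro <;> linarith
    · have hi' := not_lt.1 (mt (hcmp i).1.2 hi.not_gt)
      rw [(floor_fract_shift_of_le k hc hi).2, (floor_fract_shift_of_lt k hc1 hj).2,
        (floor_fract_shift_of_le k hc' hi').2,
        (floor_fract_shift_of_lt k hc1' ((hcmp j).1.1 hj)).2]
      constructor <;> intro <;> linarith
    · rw [(floor_fract_shift_of_le k hc hi).2, (floor_fract_shift_of_le k hc hj).2,
        (floor_fract_shift_of_le k hc' (not_lt.1 (mt (hcmp i).1.2 hi.not_gt))).2,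
        (floor_fract_shift_of_le k hc' (not_lt.1 (mt (hcmp j).1.2 hj.not_gt))).2]
      simpa using hij
  · rcases hnear with rfl | ⟨j, hj, hj'⟩
    -- An integer shift keeps the zero coordinate `o` at an integer.
    · exact ⟨o, 0, k, le_rfl, hδ.le, by rw [hyo]; ring⟩
    · refine ⟨j, c' - Int.fract (y j), k + 1 + ⌊y j⌋, by linarith, by linarith, ?_⟩
      push_cast
      linarith [Int.fract_add_floor (y j)]

/-! ### Distances to integers -/

lemma intDist_int_add {d : ℝ} (k : ℤ) (hd : |d| < 1 / 2) : intDist (k + d) = d := by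
  obtain ⟨h1, h2⟩ := abs_lt.1 hd
  rcases lt_trichotomy d 0 with h | rfl | h
  · have hc : ⌈(k : ℝ) + d⌉ = k := by rw [Int.ceil_eq_iff]; constructor <;> linarith
    have hf : ⌊(k : ℝ) + d⌋ = k - 1 := by
      rw [Int.floor_eq_iff]; push_cast; constructor <;> linarith
    rw [intDist, hc, hf, if_pos]
    · ring
    · push_cast
      rw [abs_of_nonpos (by linarith), abs_of_nonneg (by linarith)]
      linarith
  · simp [intDist]
  · have hc : ⌈(k : ℝ) + d⌉ = k + 1 := by
      rw [Int.ceil_eq_iff]; push_cast; constructor <;> linarith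
    have hf : ⌊(k : ℝ) + d⌋ = k := by
      rw [Int.floor_eq_iff]; constructor <;> linarith
    rw [intDist, hc, hf, if_neg]
    · ring
    · push_cast
      rw [abs_of_nonpos (by linarith), abs_of_nonneg (by linarith)]
      linarith

lemma exists_eq_int_add_intDist (x : ℝ) : ∃ k : ℤ, x = k + intDist x := by
  unfold intDist
  split_ifs
  · exact ⟨⌈x⌉, by ring⟩
  · exact ⟨⌊x⌋, by ring⟩

variable {V : Type*} {M : ℕ}

/-- With `State.totalDist_le`, this replaces the case distinction in the definition: the total
distance is the length of the shortest interval `[-p, q]` containing 0 and all signed distances. -/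
lemma State.exists_totalDist_eq (s : State V M) :
    ∃ p q : ℝ, 0 ≤ p ∧ 0 ≤ q ∧ s.totalDist = p + q ∧ ∀ i, -p ≤ s.dist i ∧ s.dist i ≤ q := by
  have hL : ∀ i, s.distL ≤ s.dist i := ciInf_le (Set.finite_range _).bddBelow
  have hR : ∀ i, s.dist i ≤ s.distR := le_ciSup (Set.finite_range _).bddAbove
  have hL' := neg_abs_le s.distL
  unfold State.totalDist
  split_ifs with h1 h2
  · exact ⟨_, 0, abs_nonneg _, le_rfl, by ring, fun i => ⟨hL'.trans (hL i), h1 i⟩⟩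
  · exact ⟨0, s.distR, le_rfl, Real.iSup_nonneg h2, by ring,
      fun i => ⟨by simpa using h2 i, hR i⟩⟩
  · push Not at h1
    obtain ⟨i, hi⟩ := h1
    exact ⟨_, _, abs_nonneg _, hi.le.trans (hR i), rfl, fun i => ⟨hL'.trans (hL i), hR i⟩⟩

lemma State.totalDist_le {s : State V M} {p q : ℝ} (hp : 0 ≤ p) (hq : 0 ≤ q)
    (h : ∀ i, -p ≤ s.dist i ∧ s.dist i ≤ q) : s.totalDist ≤ p + q := by
  have hR : s.distR ≤ q := Real.iSup_le (fun i => (h i).2) hq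
  have hL : -p ≤ s.distL := Real.le_iInf (fun i => (h i).1) (by linarith)
  unfold State.totalDist
  split_ifs with h1 h2
  · have : s.distL ≤ 0 := Real.iInf_nonpos h1
    rw [abs_of_nonpos this]; linarith
  · linarith
  · push Not at h2
    obtain ⟨i, hi⟩ := h2
    have : s.distL ≤ 0 := (ciInf_le (Set.finite_range _).bddBelow i).trans hi.le
    rw [abs_of_nonpos this]; linarith

/-! ### Equivalence of states -/

/-- Two extended reals are equal and infinite, or real with the same floor and ceiling. -/
lemma extFloor_extCeil_eq_iff (x y : EReal) :
    (extFloor x = extFloor y ∧ extCeil x = extCeil y) ↔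
      (x = y ∧ (x = ⊤ ∨ x = ⊥)) ∨ ((x ≠ ⊤ ∧ x ≠ ⊥) ∧ (y ≠ ⊤ ∧ y ≠ ⊥) ∧
        ⌊x.toReal⌋ = ⌊y.toReal⌋ ∧ ⌈x.toReal⌉ = ⌈y.toReal⌉) := by
  induction x <;> induction y <;> simp [extFloor, extCeil]

/-- For an integer `n`, `n < x` depends only on the ceiling of `x`, and `x < n` only on its floor.
This is where integrality of the endpoints enters. -/
lemma extInt_lt_iff {n x y : EReal} (hn : n ∈ extInt)
    (h : extFloor x = extFloor y ∧ extCeil x = extCeil y) :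
    (n < x ↔ n < y) ∧ (x < n ↔ y < n) := by
  rw [extFloor_extCeil_eq_iff] at h
  rcases h with ⟨rfl, -⟩ | ⟨hx, hy, h1, h2⟩
  · simp
  lift x to ℝ using hx
  lift y to ℝ using hy
  simp only [EReal.toReal_coe] at h1 h2
  rcases hn with rfl | rfl | ⟨n, rfl⟩
  · simp
  · simp
  · simp only [EReal.coe_lt_coe_iff]
    rw [← Int.lt_ceil, ← Int.lt_ceil, ← Int.floor_lt, ← Int.floor_lt, h1, h2]
    simp

lemma Interval.OverInt.mem_points {I : Interval} (hI : I.OverInt) {x y : EReal}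
    (h : extFloor x = extFloor y ∧ extCeil x = extCeil y) (hx : x ∈ I.points) : y ∈ I.points := by
  have key : ∀ n ∈ extInt, n = x → n = y := fun n hn e => by
    obtain ⟨h1, h2⟩ := extInt_lt_iff hn h
    exact le_antisymm (not_lt.1 (mt h2.2 e.not_gt)) (not_lt.1 (mt h1.2 e.not_lt))
  refine ⟨hx.1.imp (extInt_lt_iff hI.1 h).1.1 (And.imp_right (key _ hI.1)),
    hx.2.imp (extInt_lt_iff hI.2 h).2.1 (And.imp_right fun e => (key _ hI.2 e.symm).symm)⟩

lemma State.Equivalent.refl (s : State V M) : s.Equivalent s :=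
  ⟨rfl, fun _ => ⟨rfl, rfl⟩, fun _ _ => Iff.rfl⟩

lemma State.Equivalent.symm {s t : State V M} (h : s.Equivalent t) : t.Equivalent s :=
  ⟨h.1.symm, fun i => ⟨(h.2.1 i).1.symm, (h.2.1 i).2.symm⟩, fun i j => (h.2.2 i j).symm⟩

lemma State.Equivalent.trans {s t u : State V M} (h : s.Equivalent t) (h' : t.Equivalent u) :
    s.Equivalent u :=
  ⟨h.1.trans h'.1, fun i => ⟨(h.2.1 i).1.trans (h'.2.1 i).1, (h.2.1 i).2.trans (h'.2.1 i).2⟩,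
    fun i j => (h.2.2 i j).trans (h'.2.2 i j)⟩

lemma State.equivalent_iff {s t : State V M} : s.Equivalent t ↔ s.loc = t.loc ∧
    (∀ i, (s.var i = t.var i ∧ (s.var i = ⊤ ∨ s.var i = ⊥)) ∨
      ((s.var i ≠ ⊤ ∧ s.var i ≠ ⊥) ∧ (t.var i ≠ ⊤ ∧ t.var i ≠ ⊥))) ∧
    SameRegion (fun i => (s.var i).toReal) (fun i => (t.var i).toReal) := by
  unfold State.Equivalent SameRegion extFract
  simp only [extFloor_extCeil_eq_iff]
  constructor
  · rintro ⟨h1, h2, h3⟩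
    refine ⟨h1, fun i => (h2 i).imp_right fun h => ⟨h.1, h.2.1⟩, fun i => ?_, h3⟩
    rcases h2 i with h | h
    · rw [h.1]; exact ⟨rfl, rfl⟩
    · exact h.2.2
  · rintro ⟨h1, h2, h3, h4⟩
    exact ⟨h1, fun i => (h2 i).imp_right fun h => ⟨h.1, h.2, h3 i⟩, h4⟩

lemma mem_points_nonneg {l : Label M} {t : EReal} (ht : t ∈ l.time.points) : 0 ≤ t :=
  l.time_nonneg.trans (ht.1.elim le_of_lt fun h => h.2.le)

/-- In a flat game over the extended integers, equivalent states have equivalent successors,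
which moreover can be chosen with almost no increase of the total distance. -/
lemma IPG.exists_succ_equivalent {G : IPG V M} (hflat : G.Flat) (hint : G.OverInt)
    {s s' t : State V M} (hs : s.Equivalent s') (ht : t ∈ G.succ s) {ε δ : ℝ} (hδ : 0 < δ)
    (hεδ : ε + δ < 1 / 2) :
    ∃ t' ∈ G.succ s', t.Equivalent t' ∧
      (s'.totalDist ≤ ε → t'.totalDist ≤ s'.totalDist + δ) := by
  classical
  obtain ⟨⟨⟨e1, e2⟩, he⟩, hee, l, hl, hcon, hres, τ, hτ, hvar⟩ := ht
  simp only [Prod.mk.injEq] at hee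
  obtain ⟨rfl, rfl⟩ := hee
  have hcon' : ∀ i, s'.var i ∈ (l.constraint i).points := fun i =>
    ((hint.1 _ l hl).2 i).mem_points (hs.2.1 i) (hcon i)
  obtain ⟨hloc, hfin, hreg⟩ := State.equivalent_iff.1 hs
  simp only [hflat _ _, EReal.coe_one, one_mul] at hvar
  obtain ⟨p, q, hp, hq, hpq, hd⟩ := s'.exists_totalDist_eq
  -- A candidate for the new state, for a given elapsed time.
  have hsucc : ∀ τ' ∈ l.time.points,
      (⟨t.loc, fun i => if i ∈ l.reset then 0 else s'.var i + τ'⟩ : State V M) ∈ G.succ s' := by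
    intro τ' hτ'
    refine ⟨⟨(s.loc, t.loc), he⟩, by simp [hloc], l, hl, hcon', fun i hi => by simp [hi], τ', hτ',
      fun i hi => by simp [hi, hflat _ _]⟩
  have hτ0 := mem_points_nonneg hτ
  -- After an infinite delay every variable is 0 or infinite, so the same delay from `s'` gives
  -- exactly `t`, at distance 0.
  by_cases htop : τ = ⊤
  · subst htop
    refine ⟨_, hsucc _ hτ, ?_, fun _ => ?_⟩
    · have : t = ⟨t.loc, fun i => if i ∈ l.reset then 0 else s'.var i + ⊤⟩ := by
        obtain ⟨tl, tv⟩ := t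
        congr 1
        funext i
        by_cases hi : i ∈ l.reset
        · simpa [hi] using hres i hi
        · simp only [hi, if_false]
          refine (hvar i hi).trans ?_
          rcases hfin i with h | h
          · rw [h.1]
          · rw [EReal.add_top_of_ne_bot h.1.2, EReal.add_top_of_ne_bot h.2.2]
      rw [← this]
      exact State.Equivalent.refl t
    · refine (State.totalDist_le le_rfl le_rfl fun i => ?_).trans (by linarith : (0 : ℝ) + 0 ≤ _)
      have : State.dist (⟨t.loc, fun i => if i ∈ l.reset then 0 else s'.var i + ⊤⟩ : State V M) i
          = 0 := by
        unfold State.dist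
        dsimp only
        split_ifs
        · simp [intDist]
        · rcases eq_or_ne (s'.var i) ⊥ with h | h
          · simp [h, intDist]
          · simp [EReal.add_top_of_ne_bot h, intDist]
      simp [this]
  lift τ to ℝ using ⟨htop, fun h => by simp [h] at hτ0⟩
  -- A coordinate `none` with value 0 is adjoined. Its shifted value is the delay itself, so `τ` and
  -- `τ'` get the same floor and ceiling and lie in the same time interval.
  have hreg' : SameRegion (fun o : Option (Fin M) => o.elim 0 fun i => (s.var i).toReal)
      (fun o : Option (Fin M) => o.elim 0 fun i => (s'.var i).toReal) := by
    refine ⟨fun o => ?_, fun o o' => ?_⟩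
    · cases o with
      | none => exact ⟨rfl, rfl⟩
      | some i => exact hreg.1 i
    · cases o with
      | none => cases o' <;> simp
      | some i =>
        cases o' with
        | some j => exact hreg.2 i j
        | none =>
          have := hreg.fract_eq_zero_iff i
          simp only [Option.elim, Int.fract_zero]
          rw [(Int.fract_nonneg _).ge_iff_eq', (Int.fract_nonneg _).ge_iff_eq']
          exact this
  obtain ⟨τ', hshift, j, η, k, hη, hηδ, hτ'⟩ := hreg'.exists_shift none rfl rfl τ hδ
  have hτmem : (τ' : EReal) ∈ l.time.points := by
    refine (hint.1 _ l hl).1.mem_points ?_ hτ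
    rw [extFloor_extCeil_eq_iff]
    right
    have := hshift.1 none
    simpa using this
  refine ⟨_, hsucc _ hτmem, ?_, fun hs' => ?_⟩
  · -- coordinates that are zero or infinite in the new state
    let S : Set (Option (Fin M)) :=
      {o | o.elim False fun i => i ∈ l.reset ∨ s.var i = ⊤ ∨ s.var i = ⊥}
    have hz := hshift.zero_on S
    have hcoord : ∀ i, ((t.var i = (if i ∈ l.reset then 0 else s'.var i + τ')) ∧
        (t.var i = ⊤ ∨ t.var i = ⊥) ∧ some i ∈ S) ∨
        (t.var i = ((if some i ∈ S then 0 else (s.var i).toReal + τ : ℝ) : EReal) ∧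
        (if i ∈ l.reset then 0 else s'.var i + τ') =
          ((if some i ∈ S then 0 else (s'.var i).toReal + τ' : ℝ) : EReal)) := by
      intro i
      by_cases hi : i ∈ l.reset
      · right
        have : some i ∈ S := Or.inl hi
        simp [hi, this, hres i hi]
      · rw [hvar i hi]
        rcases hfin i with h | h
        · left
          have : some i ∈ S := Or.inr h.2
          rw [← h.1]
          simp only [hi, if_false, this]
          rcases h.2 with h | h <;> simp [h]
        · right
          have : some i ∉ S := fun hS => by
            rcases hS with hS | hS | hS
            exacts [hi hS, h.1.1 hS, h.1.2 hS]
          simp only [hi, if_false, this]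
          rw [EReal.coe_add, EReal.coe_add, EReal.coe_toReal h.1.1 h.1.2,
            EReal.coe_toReal h.2.1 h.2.2]
          exact ⟨rfl, rfl⟩
    rw [State.equivalent_iff]
    refine ⟨rfl, fun i => ?_, ?_⟩
    · rcases hcoord i with h | h
      · exact Or.inl ⟨h.1, h.2.1⟩
      · right
        dsimp only
        rw [h.1, h.2]
        exact ⟨⟨EReal.coe_ne_top _, EReal.coe_ne_bot _⟩, EReal.coe_ne_top _, EReal.coe_ne_bot _⟩
    · have e1 : ∀ i, (t.var i).toReal = if some i ∈ S then 0 else (s.var i).toReal + τ := by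
        intro i
        rcases hcoord i with h | h
        · rw [if_pos h.2.2]
          rcases h.2.1 with h | h <;> simp [h]
        · rw [h.1, EReal.toReal_coe]
      have e2 : ∀ i, (if i ∈ l.reset then 0 else s'.var i + τ').toReal =
          if some i ∈ S then 0 else (s'.var i).toReal + τ' := by
        intro i
        rcases hcoord i with h | h
        · rw [if_pos h.2.2, ← h.1]
          rcases h.2.1 with h | h <;> simp [h]
        · rw [h.2, EReal.toReal_coe]
      simp only [e1, e2]
      exact ⟨fun i => hz.1 (some i), fun i j => hz.2 (some i) (some j)⟩
  -- `u` is the signed distance of the coordinate `j` that the delay brings to distance `-η`. All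
  -- finite, non-reset variables have their distances translated by `-(u + η)`.
  · obtain ⟨u, hu, m, hm⟩ : ∃ u, (-p ≤ u ∧ u ≤ q) ∧
        ∃ m : ℤ, (j.elim 0 fun i => (s'.var i).toReal : ℝ) = m + u := by
      cases j with
      | none => exact ⟨0, ⟨by linarith, hq⟩, 0, by simp⟩
      | some j =>
        obtain ⟨m, hm⟩ := exists_eq_int_add_intDist (s'.var j).toReal
        exact ⟨_, hd j, m, hm⟩
    -- The translated interval, with its right end enlarged by `δ`, still contains 0, since `-p ≤ u
    -- ≤ q` and `0 ≤ η ≤ δ`.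
    have hle : s'.totalDist + δ = (p + (u + η)) + (q + δ - (u + η)) := by rw [hpq]; ring
    have hdist : ∀ i, State.dist
        (⟨t.loc, fun i => if i ∈ l.reset then 0 else s'.var i + τ'⟩ : State V M) i = 0 ∨
        State.dist (⟨t.loc, fun i => if i ∈ l.reset then 0 else s'.var i + τ'⟩ : State V M) i
          = s'.dist i - (u + η) := by
      intro i
      unfold State.dist
      dsimp only
      by_cases hi : i ∈ l.reset
      · left; simp [hi, intDist]
      simp only [hi, if_false]
      rcases eq_or_ne (s'.var i) ⊥ with h | h
      · left; simp [h, intDist]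
      rcases eq_or_ne (s'.var i) ⊤ with h' | h'
      · left; simp [h', intDist]
      right
      obtain ⟨n, hn⟩ := exists_eq_int_add_intDist (s'.var i).toReal
      have hdi := hd i
      unfold State.dist at hdi
      rw [EReal.toReal_add h' h (EReal.coe_ne_top _) (EReal.coe_ne_bot _), EReal.toReal_coe]
      have : (s'.var i).toReal + τ' =
          (n + k - m : ℤ) + (intDist (s'.var i).toReal - (u + η)) := by
        push_cast
        rw [hτ', hm]
        linarith
      -- The new distance is at most `p + q + δ ≤ ε + δ < 1 / 2` in absolute value, so the closest
      -- integer moves along with the variable.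
      rw [this, intDist_int_add]
      rw [abs_lt]
      constructor <;> linarith
    rw [hle]
    refine State.totalDist_le (by linarith) (by linarith) fun i => ?_
    rcases hdist i with h | h
    · rw [h]; constructor <;> linarith
    · rw [h]; constructor <;> linarith [hd i]

/-! ### Strategies that depend on regions only -/

instance State.equivalentSetoid : Setoid (State V M) where
  r := State.Equivalent
  iseqv := ⟨State.Equivalent.refl, State.Equivalent.symm, State.Equivalent.trans⟩

/-- The set of equivalence classes of states. -/
abbrev Region (V : Type*) (M : ℕ) := Quotient (State.equivalentSetoid (V := V) (M := M))

/-- The equivalence class of a state. -/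
abbrev State.region (s : State V M) : Region V M := Quotient.mk _ s

lemma State.region_eq_iff {s t : State V M} : s.region = t.region ↔ s.Equivalent t :=
  Quotient.eq

lemma map_region_eq {h h' : List (State V M)} (H : List.Forall₂ State.Equivalent h h') :
    h.map State.region = h'.map State.region := by
  induction H with
  | nil => rfl
  | cons h _ ih => rw [List.map_cons, List.map_cons, ih, State.region_eq_iff.2 h]

variable {G : IPG V M}

lemma IPG.image_region_succ (hflat : G.Flat) (hint : G.OverInt) {s s' : State V M}
    (h : s.region = s'.region) : State.region '' G.succ s = State.region '' G.succ s' := by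
  have key : ∀ {s s' : State V M}, s.region = s'.region →
      State.region '' G.succ s ⊆ State.region '' G.succ s' := by
    rintro s s' h _ ⟨t, ht, rfl⟩
    -- Only the equivalence is used, so any admissible `ε` and `δ` would do.
    obtain ⟨t', ht', htt, -⟩ := IPG.exists_succ_equivalent hflat hint (State.region_eq_iff.1 h) ht
      (ε := 0) (δ := 1 / 4) (by norm_num) (by norm_num)
    exact ⟨t', ht', (State.region_eq_iff.2 htt).symm⟩
  exact (key h).antisymm (key h.symm)

lemma IPG.succ_nonempty_congr (hflat : G.Flat) (hint : G.OverInt) {s s' : State V M}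
    (h : s.region = s'.region) : (G.succ s).Nonempty ↔ (G.succ s').Nonempty := by
  rw [← Set.image_nonempty (f := State.region), IPG.image_region_succ hflat hint h,
    Set.image_nonempty]

/-- Every choice of regions, depending on the regions of the history, is implemented by
a discrete strategy wherever it is admissible. -/
lemma IPG.exists_isDiscrete (hflat : G.Flat) (hint : G.OverInt) {ε : ℝ} (hε : 0 < ε)
    (hε' : ε < 1 / 4) (i : Fin 2) (f : List (Region V M) → Region V M → Region V M) :
    ∃ σ : G.Strategy i, σ.IsDiscrete ε ∧ ∀ h s,
      f (h.map State.region) s.region ∈ State.region '' G.succ s →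
        (σ.move h s).region = f (h.map State.region) s.region := by
  classical
  let R : Region V M → Set (Region V M) := fun q => State.region '' G.succ q.out
  have hR : ∀ s : State V M, R s.region = State.region '' G.succ s := fun s =>
    IPG.image_region_succ hflat hint (Quotient.out_eq _)
  -- The fallback for inadmissible choices is also made on regions, so that equivalent histories
  -- still get equivalent moves.
  let g : List (Region V M) → Region V M → Region V M := fun h q =>
    if f h q ∈ R q then f h q else if hne : (R q).Nonempty then hne.some else q
  have hg : ∀ h q, (R q).Nonempty → g h q ∈ R q := fun h q hne => by
    dsimp only [g]
    split_ifs with h1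
    · exact h1
    · exact hne.some_mem
  have hmove : ∀ (h : List (State V M)) (s : State V M), ∃ t, (G.succ s).Nonempty →
      t ∈ G.succ s ∧ t.region = g (h.map State.region) s.region ∧
        (s.totalDist ≤ ε → t.totalDist ≤ s.totalDist + ε / 2 ^ (h.length + 1)) := by
    intro h s
    by_cases hne : (G.succ s).Nonempty
    · obtain ⟨t, ht, e⟩ : g (h.map State.region) s.region ∈ State.region '' G.succ s := by
        rw [← hR]
        exact hg _ _ (by rw [hR]; exact hne.image _)
      -- With `δ = ε / 2 ^ (h.length + 1)` this gives `ε + δ ≤ 2 * ε < 1 / 2`, by `ε < 1 / 4`.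
      have hpow : ε / 2 ^ (h.length + 1) ≤ ε :=
        div_le_self hε.le (one_le_pow₀ one_le_two)
      obtain ⟨t', ht', htt, hd⟩ := IPG.exists_succ_equivalent hflat hint (State.Equivalent.refl s)
        ht (ε := ε) (δ := ε / 2 ^ (h.length + 1)) (by positivity) (by linarith)
      exact ⟨t', fun _ => ⟨ht', by rw [← e, State.region_eq_iff]; exact htt.symm, hd⟩⟩
    · exact ⟨s, fun h => absurd h hne⟩
  choose mv hmv using hmove
  refine ⟨⟨mv, fun h s _ hne => (hmv h s hne).1⟩, ⟨fun h s _ hne => (hmv h s hne).2.2, ?_⟩, ?_⟩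
  · intro h s h' s' _ hne hne' hh hs
    rw [← State.region_eq_iff, (hmv h s hne).2.1, (hmv h' s' hne').2.1, map_region_eq hh,
      State.region_eq_iff.2 hs]
  · intro h s hf
    rw [(hmv h s (hf.imp fun _ h => h.1)).2.1]
    exact if_pos (by rwa [hR])

/-! ### Plays -/

lemma IPG.play_succ_of_nonempty {σ : G.Strategy 0} {ρ : G.Strategy 1} {s : State V M} {n : ℕ}
    (h : (G.succ (G.play σ ρ s n).2).Nonempty) :
    G.play σ ρ s (n + 1) = ((G.play σ ρ s n).1 ++ [(G.play σ ρ s n).2],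
      open Classical in if G.owner (G.play σ ρ s n).2.loc = 0
        then σ.move (G.play σ ρ s n).1 (G.play σ ρ s n).2
        else ρ.move (G.play σ ρ s n).1 (G.play σ ρ s n).2) := by
  rw [IPG.play]
  simp only [h, if_true]

lemma IPG.play_succ_of_not_nonempty {σ : G.Strategy 0} {ρ : G.Strategy 1} {s : State V M} {n : ℕ}
    (h : ¬(G.succ (G.play σ ρ s n).2).Nonempty) : G.play σ ρ s (n + 1) = G.play σ ρ s n := by
  rw [IPG.play]
  simp only [h, if_false]

/-- It lets a strategy read the round from its history. Nonemptiness is needed because the history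
stops growing once the play has ended. -/
lemma IPG.length_play {σ : G.Strategy 0} {ρ : G.Strategy 1} {s : State V M} {n : ℕ}
    (h : (G.succ (G.play σ ρ s n).2).Nonempty) : (G.play σ ρ s n).1.length = n := by
  induction n with
  | zero => rfl
  | succ n ih =>
    by_cases hn : (G.succ (G.play σ ρ s n).2).Nonempty
    · rw [IPG.play_succ_of_nonempty hn]
      simp [ih hn]
    · rw [IPG.play_succ_of_not_nonempty hn] at h
      exact absurd h hn

/-! ### Payoffs -/

/-- Infinite values are equal and real ones with the same floor differ by less than 1. The bound on
`a` makes it finite, and an infinite `b` absorbs the difference. -/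
lemma affine_le_affine_add {a b x y : EReal} (h : extFloor x = extFloor y ∧ extCeil x = extCeil y)
    {m : ℝ} (hm : 0 ≤ m) (ha : a.abs ≤ ENNReal.ofReal m) : a * x + b ≤ a * y + b + m := by
  have hm' : (0 : EReal) ≤ m := EReal.coe_nonneg.2 hm
  have hma : a ≠ ⊤ ∧ a ≠ ⊥ := by
    constructor <;> rintro rfl <;> simp at ha
  lift a to ℝ using hma
  rw [extFloor_extCeil_eq_iff] at h
  rcases h with ⟨rfl, -⟩ | ⟨hx, hy, h1, -⟩
  · exact le_add_of_nonneg_right hm'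
  lift x to ℝ using hx
  lift y to ℝ using hy
  rw [← EReal.coe_mul, ← EReal.coe_mul]
  induction b with
  | bot => simp
  | top => rw [EReal.coe_add_top, EReal.coe_add_top, EReal.top_add_coe]
  | coe b =>
    rw [EReal.abs_def, ENNReal.ofReal_le_ofReal_iff hm] at ha
    simp only [EReal.toReal_coe] at h1
    norm_cast
    have hxy : |x - y| ≤ 1 := (Int.abs_sub_lt_one_of_floor_eq_floor h1).le
    have : a * (x - y) ≤ m := calc
      a * (x - y) ≤ |a * (x - y)| := le_abs_self _
      _ = |a| * |x - y| := abs_mul _ _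
      _ ≤ |a| * 1 := by gcongr
      _ ≤ m := by linarith
    linarith

/-- Plays that visit the same regions have almost the same payoff. -/
lemma IPG.pay_le_pay_add (hflat : G.Flat) (hint : G.OverInt) {σ σ' : G.Strategy 0}
    {ρ ρ' : G.Strategy 1} {s s' : State V M}
    (h : ∀ n, (G.play σ ρ s n).2.region = (G.play σ' ρ' s' n).2.region) {m : ℝ} (hm : 0 ≤ m)
    (hG : G.maxMult ≤ ENNReal.ofReal m) : G.pay σ ρ s ≤ G.pay σ' ρ' s' + m := by
  classical
  have hm' : (0 : EReal) ≤ m := EReal.coe_nonneg.2 hm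
  have hloc : ∀ n, (G.play σ ρ s n).2.loc = (G.play σ' ρ' s' n).2.loc := fun n =>
    (State.region_eq_iff.1 (h n)).1
  have hend : ∀ n, G.succ (G.play σ ρ s n).2 = ∅ ↔ G.succ (G.play σ' ρ' s' n).2 = ∅ := fun n => by
    rw [← Set.not_nonempty_iff_eq_empty, ← Set.not_nonempty_iff_eq_empty,
      IPG.succ_nonempty_congr hflat hint (h n)]
  by_cases hex : ∃ n, G.succ (G.play σ ρ s n).2 = ∅
  · have hex' : ∃ n, G.succ (G.play σ' ρ' s' n).2 = ∅ := hex.imp fun n => (hend n).1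
    have hfind : Nat.find hex = Nat.find hex' := Nat.find_congr' (hend _)
    rw [IPG.pay, IPG.pay, dif_pos hex, dif_pos hex', hfind]
    generalize Nat.find hex' = n
    obtain ⟨h1, h2, -⟩ := State.region_eq_iff.1 (h n)
    rw [IPG.finalPay, IPG.finalPay, h1]
    exact affine_le_affine_add (h2 _) hm ((le_iSup (fun v => (G.mult v).abs) _).trans hG)
  · have hex' : ¬∃ n, G.succ (G.play σ' ρ' s' n).2 = ∅ :=
      fun h => hex (h.imp fun n => (hend n).2)
    rw [IPG.pay, IPG.pay, dif_neg hex, dif_neg hex']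
    have : (G.lowestPriority fun n => (G.play σ ρ s n).2) =
        G.lowestPriority fun n => (G.play σ' ρ' s' n).2 := by
      simp only [IPG.lowestPriority, hloc]
    rw [this]
    exact le_add_of_nonneg_right hm'

/-! ### Simulations -/

lemma IPG.eq_one_of_owner_ne {s : State V M} (h : G.owner s.loc ≠ 0) : G.owner s.loc = 1 := by
  omega

/-- Against a discrete strategy of player `0`, player `1` can follow the regions of any play
by a discrete strategy. -/
lemma IPG.exists_discrete_response (hflat : G.Flat) (hint : G.OverInt) {ε : ℝ} (hε : 0 < ε)
    (hε' : ε < 1 / 4) {σ : G.Strategy 0} (hσ : σ.IsDiscrete ε) (ρ : G.Strategy 1)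
    (s : State V M) : ∃ ρ' : G.Strategy 1, ρ'.IsDiscrete ε ∧
      ∀ n, (G.play σ ρ s n).2.region = (G.play σ ρ' s n).2.region := by
  obtain ⟨ρ', hρ', hmove⟩ := IPG.exists_isDiscrete hflat hint hε hε' 1
    -- The reply announces the next region of the fixed play and reads only the round.
    fun h _ => (G.play σ ρ s (h.length + 1)).2.region
  refine ⟨ρ', hρ', ?_⟩
  suffices H : ∀ n, List.Forall₂ State.Equivalent (G.play σ ρ s n).1 (G.play σ ρ' s n).1 ∧
      (G.play σ ρ s n).2.region = (G.play σ ρ' s n).2.region from fun n => (H n).2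
  intro n
  induction n with
  | zero => exact ⟨.nil, rfl⟩
  | succ n ih =>
    obtain ⟨ih1, ih2⟩ := ih
    have heq := State.region_eq_iff.1 ih2
    have hne := IPG.succ_nonempty_congr hflat hint ih2
    by_cases h : (G.succ (G.play σ ρ s n).2).Nonempty
    · have h' := hne.1 h
      rw [IPG.play_succ_of_nonempty h']
      refine ⟨?_, ?_⟩
      · rw [IPG.play_succ_of_nonempty h]
        exact List.rel_append ih1 (.cons heq .nil)
      · by_cases ho : G.owner (G.play σ ρ s n).2.loc = 0
        · rw [IPG.play_succ_of_nonempty h]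
          simp only [← heq.1, ho, if_true]
          -- Discreteness of `σ` enters here: equivalent histories get equivalent moves.
          exact State.region_eq_iff.2 (hσ.2 _ _ _ _ ho h h' ih1 heq)
        · simp only [← heq.1, ho, if_false]
          rw [hmove]
          · rw [List.length_map, IPG.length_play h']
          · rw [List.length_map, IPG.length_play h', ← IPG.image_region_succ hflat hint ih2,
              IPG.play_succ_of_nonempty h]
            simp only [ho, if_false]
            exact Set.mem_image_of_mem _ (ρ.move_mem _ _ (IPG.eq_one_of_owner_ne ho) h)
    · rw [IPG.play_succ_of_not_nonempty h, IPG.play_succ_of_not_nonempty (mt hne.2 h)]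
      exact ⟨ih1, ih2⟩

/-- A successor of a given state in a given region, if there is one. -/
lemma IPG.exists_pick (G : IPG V M) : ∃ pick : State V M → Region V M → State V M,
    (∀ c q, q ∈ State.region '' G.succ c → (pick c q).region = q) ∧
      ∀ c q, (G.succ c).Nonempty → pick c q ∈ G.succ c := by
  have : ∀ c q, ∃ t, (q ∈ State.region '' G.succ c → t.region = q) ∧
      ((G.succ c).Nonempty → t ∈ G.succ c) := by
    intro c q
    by_cases h : q ∈ State.region '' G.succ c
    · obtain ⟨t, ht, rfl⟩ := h
      exact ⟨t, fun _ => rfl, fun _ => ht⟩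
    · by_cases hne : (G.succ c).Nonempty
      · exact ⟨hne.some, fun h' => absurd h' h, fun _ => hne.some_mem⟩
      · exact ⟨c, fun h' => absurd h' h, fun h' => absurd h' hne⟩
  choose pick h1 h2 using this
  exact ⟨pick, h1, h2⟩

open Classical in
/-- One step of the simulation of a play in a prescribed region: player `0` uses the strategy `σ`,
player `1` moves to the prescribed region. -/
def IPG.simStep (σ : G.Strategy 0) (pick : State V M → Region V M → State V M)
    (x : List (State V M) × State V M) (q : Region V M) : List (State V M) × State V M :=
  (x.1 ++ [x.2], if G.owner x.2.loc = 0 then σ.move x.1 x.2 else pick x.2 q)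

/-- Every strategy of player `0` is simulated by a discrete strategy, in the sense that
every play against the latter visits the same regions as some play against the former. -/
lemma IPG.exists_discrete_simulation (hflat : G.Flat) (hint : G.OverInt) {ε : ℝ} (hε : 0 < ε)
    (hε' : ε < 1 / 4) (σ : G.Strategy 0) (s : State V M) :
    ∃ σ' : G.Strategy 0, σ'.IsDiscrete ε ∧ ∀ ρ' : G.Strategy 1, ∃ ρ : G.Strategy 1,
      ∀ n, (G.play σ ρ s n).2.region = (G.play σ' ρ' s n).2.region := by
  obtain ⟨pick, hpick, hpick_mem⟩ := G.exists_pick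
  -- Reconstructs a play of `σ` through the given regions. The first region is dropped because the
  -- start state `s` is known.
  let sim : List (Region V M) → List (State V M) × State V M := fun L =>
    L.tail.foldl (IPG.simStep σ pick) ([], s)
  obtain ⟨σ', hσ', hmove⟩ := IPG.exists_isDiscrete hflat hint hε hε' 0
    fun h q => (σ.move (sim (h ++ [q])).1 (sim (h ++ [q])).2).region
  refine ⟨σ', hσ', fun ρ' => ?_⟩
  -- `ρ` picks by the same function as `sim`, so its play against `σ` is the reconstructed one; this
  -- is the second half of the invariant `H`.
  let ρ : G.Strategy 1 := ⟨fun h c => pick c (G.play σ' ρ' s (h.length + 1)).2.region,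
    fun h c _ hne => hpick_mem c _ hne⟩
  refine ⟨ρ, ?_⟩
  suffices H : ∀ n, (G.play σ ρ s n).2.region = (G.play σ' ρ' s n).2.region ∧
      sim ((G.play σ' ρ' s n).1.map State.region ++ [(G.play σ' ρ' s n).2.region]) =
        G.play σ ρ s n from fun n => (H n).1
  intro n
  induction n with
  | zero => exact ⟨rfl, rfl⟩
  | succ n ih =>
    obtain ⟨ih1, ih2⟩ := ih
    have hloc := (State.region_eq_iff.1 ih1).1
    have hne := IPG.succ_nonempty_congr hflat hint ih1
    have himg := IPG.image_region_succ hflat hint ih1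
    by_cases h : (G.succ (G.play σ ρ s n).2).Nonempty
    · have h' := hne.1 h
      have hρ : ρ.move (G.play σ ρ s n).1 (G.play σ ρ s n).2 =
          pick (G.play σ ρ s n).2 (G.play σ' ρ' s (n + 1)).2.region := by
        simp only [ρ, IPG.length_play h]
      constructor
      · rw [IPG.play_succ_of_nonempty h]
        by_cases ho : G.owner (G.play σ ρ s n).2.loc = 0
        · rw [IPG.play_succ_of_nonempty h']
          simp only [← hloc, ho, if_true]
          rw [hmove] <;> rw [ih2]
          rw [← himg]
          exact Set.mem_image_of_mem _ (σ.move_mem _ _ ho h)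
        · simp only [ho, if_false]
          rw [hρ]
          refine hpick _ _ ?_
          rw [himg, IPG.play_succ_of_nonempty h']
          simp only [← hloc, ho, if_false]
          exact Set.mem_image_of_mem _
            (ρ'.move_mem _ _ (by rw [← hloc]; exact IPG.eq_one_of_owner_ne ho) h')
      · have e : (G.play σ' ρ' s (n + 1)).1 =
            (G.play σ' ρ' s n).1 ++ [(G.play σ' ρ' s n).2] := by
          rw [IPG.play_succ_of_nonempty h']
        rw [e, List.map_append, List.map_singleton]
        dsimp only [sim] at ih2 ⊢
        rw [List.tail_append_of_ne_nil (by simp), List.foldl_append, ih2,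
          IPG.play_succ_of_nonempty h, hρ]
        rfl
    · rw [IPG.play_succ_of_not_nonempty h, IPG.play_succ_of_not_nonempty (mt hne.2 h)]
      exact ⟨ih1, ih2⟩

/-! ### Values -/

lemma extDist_le_of_le_add {x y : EReal} {m : ℝ} (h1 : x ≤ y + m) (h2 : y ≤ x + m) :
    extDist x y ≤ ENNReal.ofReal m := by
  unfold extDist
  split_ifs with h
  · exact zero_le
  -- As `m` is real, an infinite value on one side forces the same value on the other, so only two
  -- reals remain.
  have hne : ∀ a : ℝ, (a : EReal) + m ≠ ⊤ := fun a => by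
    rw [← EReal.coe_add]
    exact EReal.coe_ne_top _
  induction x <;> induction y <;> simp_all
  norm_cast at h1 h2
  rw [← EReal.coe_sub, EReal.abs_def]
  exact ENNReal.ofReal_le_ofReal (abs_le.2 ⟨by linarith, by linarith⟩)

end IntervalGame

end

theorem mainTheorem3 {V : Type*} {M : ℕ} (G : IntervalGame.IPG V M)
    (hflat : G.Flat) (hint : G.OverInt) (ε : ℝ) (hε : 0 < ε) (hε' : ε < 1 / 4)
    (s : IntervalGame.State V M) :
    IntervalGame.extDist (G.supInf s) (G.discreteSupInf ε s) ≤ G.maxMult := by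
  by_cases htop : G.maxMult = ⊤
  · rw [htop]; exact le_top
  have hG := (ENNReal.ofReal_toReal htop).symm
  have hm : 0 ≤ G.maxMult.toReal := ENNReal.toReal_nonneg
  generalize G.maxMult.toReal = m at hG hm
  -- Subtracting `m` on the left allows the supremum and infimum on the right to be handled without
  -- an added constant.
  have hsub : ∀ {x y : EReal}, x - m ≤ y ↔ x ≤ y + m := fun {x y} =>
    EReal.sub_le_iff_le_add (Or.inl (EReal.coe_ne_bot m)) (Or.inl (EReal.coe_ne_top m))
  rw [hG]
  refine IntervalGame.extDist_le_of_le_add ?_ ?_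
  · refine iSup_le fun σ => ?_
    obtain ⟨σ', hσ', hsim⟩ := IntervalGame.IPG.exists_discrete_simulation hflat hint hε hε' σ s
    rw [← hsub]
    refine le_iSup_of_le ⟨σ', hσ'⟩ (le_iInf fun ρ' => ?_)
    obtain ⟨ρ, hρ⟩ := hsim ρ'.1
    rw [hsub]
    exact (iInf_le _ ρ).trans (IntervalGame.IPG.pay_le_pay_add hflat hint hρ hm hG.le)
  · refine iSup_le fun σ => ?_
    rw [← hsub]
    refine le_iSup_of_le σ.1 (le_iInf fun ρ => ?_)
    obtain ⟨ρ', hρ', h⟩ :=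
      IntervalGame.IPG.exists_discrete_response hflat hint hε hε' σ.2 ρ s
    rw [hsub]
    exact (iInf_le _ ⟨ρ', hρ'⟩).trans
      (IntervalGame.IPG.pay_le_pay_add hflat hint (fun n => (h n).symm) hm hG.le)
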